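/- Let $n\ge 1$ and let $\alpha:\{0,1,\dots,n\}\to[0,\infty)$ be monotone increasing with $\alpha(0)=0$ and $\alpha(1)>0$. Put $c_i=\alpha(i)-\alpha(i-1)$ for $i=1,\dots,n$. For a positive semidefinite matrix $a\in M_n(\mathbb C)$ let $\lambda_1(a)\ge\lambda_2(a)\ge\dots\ge\lambda_n(a)$ be its eigenvalues in decreasing order, counted with multiplicity, and let $$\varphi_\alpha(a)=\sum_{i=1}^{n-1}(\lambda_i(a)-\lambda_{i+1}(a))\,\alpha(i)+\lambda_n(a)\,\alpha(n)$$ be the non-linear trace of Choquet type associated with $\alpha$. For $a\in M_n(\mathbb C)$ put $|a|=(a^*a)^{1/2}$ and $|||a|||_\alpha=\varphi_\alpha(|a|)$. Then the following conditions are equivalent: (1) $\alpha$ is concave in the sense that $\frac{\alpha(i+1)+\alpha(i-1)}{2}\le\alpha(i)$ for $i=1,2,\dots,n-1$; (2) $(c_i)_i$ is a decreasing sequence: $c_1\ge c_2\ge\dots\ge c_n$; (3) $|||\cdot|||_\alpha$ is a unitarily invariant norm on $M_n(\mathbb C)$, i.e. a norm on this complex vector space with $|||uav|||_\alpha=|||a|||_\alpha$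 for all $a\in M_n(\mathbb C)$ and all unitaries $u,v\in M_n(\mathbb C)$; (4) $|||\cdot|||_\alpha$ is 2-positive, i.e. for all $a,b,c\in M_n(\mathbb C)$ with $\begin{pmatrix}a&c\\c^*&b\end{pmatrix}\ge 0$ one has $\begin{pmatrix}|||a|||_\alpha&|||c|||_\alpha\\|||c^*|||_\alpha&|||b|||_\alpha\end{pmatrix}\ge 0$. -/

import Mathlib

open scoped ComplexOrder

/-- `decrEigenvalue ha i` is the `i`-th eigenvalue `λ_i(a)` of the positive semidefinite matrix `a`,
where `λ_1(a) ≥ λ_2(a) ≥ ⋯ ≥ λ_n(a)` is the list of the eigenvalues in decreasing order, counted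
with multiplicity. The index `i` runs through `1, …, n` (the value at other indices is `0` and is
never used). -/
noncomputable def decrEigenvalue {n : ℕ} {a : Matrix (Fin n) (Fin n) ℂ}
    (ha : a.PosSemidef) (i : ℕ) : ℝ :=
  if h : 1 ≤ i ∧ i ≤ n then
    ha.isHermitian.eigenvalues₀ (Fin.cast (Fintype.card_fin n).symm ⟨i - 1, by omega⟩)
  else 0

/-- The non-linear trace of Choquet type `φ_α` on the positive semidefinite `n × n` matrices. Only the
values of `α` on `{0, 1, …, n}` matter. -/
noncomputable def choquetTrace (α : ℕ → ℝ) {n : ℕ} {a : Matrix (Fin n) (Fin n) ℂ}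
    (ha : a.PosSemidef) : ℝ :=
  ∑ i ∈ Finset.Ico 1 n, (decrEigenvalue ha i - decrEigenvalue ha (i + 1)) * α i
    + decrEigenvalue ha n * α n

/-- The absolute value `|a| = (a* a)^{1/2}` of a complex square matrix. -/
noncomputable def matrixAbs {n : ℕ} (a : Matrix (Fin n) (Fin n) ℂ) : Matrix (Fin n) (Fin n) ℂ :=
  open scoped MatrixOrder in CFC.abs a

theorem matrixAbs_posSemidef {n : ℕ} (a : Matrix (Fin n) (Fin n) ℂ) :
    (matrixAbs a).PosSemidef := by
  open scoped MatrixOrder in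
  exact Matrix.nonneg_iff_posSemidef.mp (CFC.abs_nonneg a)

/-- `|||a|||_α = φ_α(|a|)`. -/
noncomputable def choquetNorm (α : ℕ → ℝ) {n : ℕ} (a : Matrix (Fin n) (Fin n) ℂ) : ℝ :=
  choquetTrace α (matrixAbs_posSemidef a)

/-- `N` is a unitarily invariant norm on the complex vector space `M_n(ℂ)`. -/
structure IsUnitarilyInvariantNorm {n : ℕ} (N : Matrix (Fin n) (Fin n) ℂ → ℝ) : Prop where
  nonneg : ∀ a, 0 ≤ N a
  eq_zero_iff : ∀ a, N a = 0 ↔ a = 0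
  smul : ∀ (z : ℂ) (a), N (z • a) = ‖z‖ * N a
  add_le : ∀ a b, N (a + b) ≤ N a + N b
  unitary_mul_mul : ∀ u ∈ Matrix.unitaryGroup (Fin n) ℂ, ∀ v ∈ Matrix.unitaryGroup (Fin n) ℂ,
    ∀ a, N (u * a * v) = N a

/-- A (not necessarily linear) functional `φ : M_n(ℂ) → ℂ` is 2-positive if the `2 × 2` matrix
`[φ(a), φ(c); φ(c*), φ(b)]` is positive semidefinite whenever the operator matrix `[a, c; c*, b]`
is. -/
def IsTwoPositive {n : ℕ} (φ : Matrix (Fin n) (Fin n) ℂ → ℂ) : Prop :=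
  ∀ a b c : Matrix (Fin n) (Fin n) ℂ,
    (Matrix.fromBlocks a c c.conjTranspose b).PosSemidef →
      (!![φ a, φ c; φ c.conjTranspose, φ b] : Matrix (Fin 2) (Fin 2) ℂ).PosSemidef

open Matrix

/-! Abel summation turns `φ_α(|a|)` into `∑ c_i s_i(a)`, with `s_1 ≥ s_2 ≥ …` the singular values of
`a`. If `c` is decreasing, then `Re ∑ c_i (u a v)_ii ≤ |||a|||_α` for all unitaries `u`, `v`
(`re_sum_increments_mul_le_choquetNorm`), with equality when `u a v` is the decreasing diagonal of
singular values. So `|||·|||_α` is a maximum of real-linear functionals, which gives the triangle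
inequality. The same bound, applied to the diagonal blocks of a positive block matrix whose corner
has been diagonalized, gives 2-positivity.

Conversely, diagonal matrices that differ only in two adjacent entries turn either property into the
concavity inequality at one index. -/

/-- The increments `α (i + 1) - α i`, indexed by `Fin n`. -/
def increments (α : ℕ → ℝ) (n : ℕ) (i : Fin n) : ℝ := α (i + 1) - α i

/-! ### Eigenvalue lists and the Abel-summed trace -/

theorem sum_Ico_sub_mul_add_eq (α f : ℕ → ℝ) (h0 : α 0 = 0) (n : ℕ) :
    ∑ i ∈ Finset.Ico 1 n, (f i - f (i + 1)) * α i + f n * α n =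
      ∑ i ∈ Finset.range n, (α (i + 1) - α i) * f (i + 1) := by
  induction n with
  | zero => simp [h0]
  | succ k ih =>
    rw [Finset.sum_range_succ, ← ih]
    rcases Nat.eq_zero_or_pos k with rfl | hk
    · simp [h0, mul_comm]
    · rw [Finset.sum_Ico_succ_top hk]
      ring

theorem choquetTrace_eq_sum (α : ℕ → ℝ) (h0 : α 0 = 0) {n : ℕ} {a : Matrix (Fin n) (Fin n) ℂ}
    (ha : a.PosSemidef) :
    choquetTrace α ha = ∑ i : Fin n, increments α n i *
      ha.isHermitian.eigenvalues₀ (Fin.cast (Fintype.card_fin n).symm i) := by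
  rw [choquetTrace, sum_Ico_sub_mul_add_eq α _ h0, Finset.sum_range]
  refine Finset.sum_congr rfl fun i _ => ?_
  rw [decrEigenvalue, dif_pos ⟨by omega, by omega⟩]
  rfl

/-- The eigenvalues of a unitary conjugate of a decreasing real diagonal matrix. -/
theorem eigenvalues₀_eq_of_eq_conj_diagonal {n : ℕ} {a v : Matrix (Fin n) (Fin n) ℂ}
    (ha : a.IsHermitian) (hv : v ∈ unitaryGroup (Fin n) ℂ) {d : Fin n → ℝ} (hd : Antitone d)
    (h : a = star v * diagonal (fun i => (d i : ℂ)) * v) (i : Fin n) :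
    ha.eigenvalues₀ (Fin.cast (Fintype.card_fin n).symm i) = d i := by
  have hc : a.charpoly = (diagonal (fun i => (d i : ℂ))).charpoly := by
    rw [h, Matrix.charpoly_mul_comm, ← mul_assoc, (mem_unitaryGroup_iff).1 hv, one_mul]
  have hr : (diagonal (fun i => (d i : ℂ))).charpoly.roots =
      Finset.univ.val.map (fun i => (d i : ℂ)) := by
    rw [charpoly_diagonal, Finset.prod_eq_multiset_prod]
    simpa [Multiset.map_map, Function.comp_def] using Polynomial.roots_multiset_prod_X_sub_C
      ((Finset.univ : Finset (Fin n)).val.map fun i => (d i : ℂ))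
  have hs := ha.sort_roots_charpoly_eq_eigenvalues₀
  rw [hc, hr] at hs
  have hsd : List.ofFn d = List.ofFn ha.eigenvalues₀ := by
    rw [← hs]
    simp_rw [Fin.univ_val_map, Multiset.map_coe, List.map_ofFn,
      Function.comp_def, RCLike.re_eq_complex_re, Complex.ofReal_re, Multiset.coe_sort]
    symm
    apply List.mergeSort_of_pairwise
    simp_rw [decide_eq_true_eq, ← List.sortedGE_iff_pairwise]
    exact hd.sortedGE_ofFn
  have key : List.ofFn d =
      List.ofFn (fun i => ha.eigenvalues₀ (Fin.cast (Fintype.card_fin n).symm i)) :=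
    hsd.trans (List.ofFn_congr (Fintype.card_fin n) ha.eigenvalues₀)
  exact (congrFun (List.ofFn_inj.1 key) i).symm

theorem exists_unitary_conj_eq_diagonal {n : ℕ} {a : Matrix (Fin n) (Fin n) ℂ}
    (ha : a.IsHermitian) : ∃ v ∈ unitaryGroup (Fin n) ℂ, ∃ d : Fin n → ℝ, Antitone d ∧
      (∀ i, ∃ j, d i = ha.eigenvalues j) ∧
      a = star v * diagonal (fun i => (d i : ℂ)) * v := by
  let e : Fin n ≃ Fin n := (finCongr (Fintype.card_fin n).symm).trans
    (Fintype.equivOfCardEq (Fintype.card_fin _))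
  have he : ∀ i, ha.eigenvalues (e i) = ha.eigenvalues₀ (Fin.cast (Fintype.card_fin n).symm i) := by
    intro i
    simp [e, IsHermitian.eigenvalues]
  have hw := mem_unitaryGroup_iff.1 ha.eigenvectorUnitary.2
  have hw' := mem_unitaryGroup_iff'.1 ha.eigenvectorUnitary.2
  set w : Matrix (Fin n) (Fin n) ℂ := ha.eigenvectorUnitary.1 with hwdef
  refine ⟨(star w).submatrix e id, ?_, fun i => ha.eigenvalues (e i), fun i j hij => ?_,
    fun i => ⟨e i, rfl⟩, ?_⟩
  · rw [mem_unitaryGroup_iff]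
    have : star ((star w).submatrix e id) = w.submatrix id e := by
      ext; simp [star_apply]
    rw [this, ← submatrix_mul _ _ _ _ _ Function.bijective_id, hw', submatrix_one_equiv]
  · simp only [he]
    exact ha.eigenvalues₀_antitone (by simpa using hij)
  · have : star ((star w).submatrix e id) = w.submatrix id e := by
      ext; simp [star_apply]
    rw [this]
    have h2 : diagonal (fun i => ((ha.eigenvalues (e i) : ℝ) : ℂ)) =
      (diagonal (fun i => (ha.eigenvalues i : ℂ))).submatrix e e := by
      simp [submatrix_diagonal_equiv, Function.comp_def]
    rw [h2, submatrix_mul_equiv, submatrix_mul_equiv, submatrix_id_id]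
    exact ha.spectral_theorem

/-! ### Absolute value and singular value decomposition -/

theorem matrixAbs_eq {n : ℕ} {a p : Matrix (Fin n) (Fin n) ℂ} (hp : p.PosSemidef)
    (h : p * p = star a * a) : matrixAbs a = p := by
  open scoped MatrixOrder in
  exact CFC.sqrt_unique h (Matrix.nonneg_iff_posSemidef.mpr hp)

theorem matrixAbs_mul_self {n : ℕ} (a : Matrix (Fin n) (Fin n) ℂ) :
    matrixAbs a * matrixAbs a = star a * a := by
  open scoped MatrixOrder in
  exact CFC.abs_mul_abs a

theorem matrixAbs_unitary_mul_diagonal_mul {n : ℕ} {u v : Matrix (Fin n) (Fin n) ℂ}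
    (hu : u ∈ unitaryGroup (Fin n) ℂ) (hv : v ∈ unitaryGroup (Fin n) ℂ) {d : Fin n → ℝ}
    (hd : 0 ≤ d) :
    matrixAbs (u * diagonal (fun i => (d i : ℂ)) * v) =
      star v * diagonal (fun i => (d i : ℂ)) * v := by
  have hD : (diagonal (fun i => (d i : ℂ))).PosSemidef :=
    PosSemidef.diagonal fun i => by simpa using hd i
  apply matrixAbs_eq
  · exact hD.conjTranspose_mul_mul_same v
  · have hs : star (diagonal (fun i => (d i : ℂ))) = diagonal (fun i => (d i : ℂ)) :=
      hD.isHermitian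
    have hu' := mem_unitaryGroup_iff'.1 hu
    have hv' := mem_unitaryGroup_iff.1 hv
    simp only [star_mul, hs, mul_assoc]
    rw [← mul_assoc v, hv', one_mul, ← mul_assoc (star u), hu', one_mul]

theorem choquetNorm_unitary_mul_diagonal_mul (α : ℕ → ℝ) (h0 : α 0 = 0) {n : ℕ}
    {u v : Matrix (Fin n) (Fin n) ℂ}
    (hu : u ∈ unitaryGroup (Fin n) ℂ) (hv : v ∈ unitaryGroup (Fin n) ℂ) {d : Fin n → ℝ}
    (hd : 0 ≤ d) (hd' : Antitone d) :
    choquetNorm α (u * diagonal (fun i => (d i : ℂ)) * v) =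
      ∑ i, increments α n i * d i := by
  rw [choquetNorm, choquetTrace_eq_sum α h0]
  refine Finset.sum_congr rfl fun i _ => ?_
  rw [eigenvalues₀_eq_of_eq_conj_diagonal _ hv hd' (matrixAbs_unitary_mul_diagonal_mul hu hv hd)]

/-- Singular value decomposition of a complex square matrix. -/
theorem exists_singular_value_decomposition {n : ℕ} (a : Matrix (Fin n) (Fin n) ℂ) :
    ∃ u ∈ unitaryGroup (Fin n) ℂ, ∃ v ∈ unitaryGroup (Fin n) ℂ, ∃ d : Fin n → ℝ,
      0 ≤ d ∧ Antitone d ∧ a = u * diagonal (fun i => (d i : ℂ)) * v := by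
  obtain ⟨v, hv, d, hd, hd0, h⟩ :=
    exists_unitary_conj_eq_diagonal (matrixAbs_posSemidef a).isHermitian
  have hd0 : 0 ≤ d := fun i => by
    obtain ⟨j, hj⟩ := hd0 i
    rw [hj]; exact (matrixAbs_posSemidef a).eigenvalues_nonneg j
  have hv' := mem_unitaryGroup_iff.1 hv
  have hv'' := mem_unitaryGroup_iff'.1 hv
  -- The columns of `b` are orthogonal with norms `d i`, so `b = u * diagonal d` once they are
  -- normalized.
  set b := a * star v with hb
  have hbb : star b * b = diagonal (fun i => ((d i : ℂ)) * (d i : ℂ)) := by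
    rw [← diagonal_mul_diagonal]
    have := matrixAbs_mul_self a
    rw [hb, star_mul, star_star, mul_assoc, ← mul_assoc (star a), ← this, h]
    simp only [mul_assoc]
    rw [hv', mul_one, ← mul_assoc v, hv', one_mul, ← mul_assoc v, hv', one_mul]
  let f : Fin n → EuclideanSpace ℂ (Fin n) := fun j => WithLp.toLp 2 (fun i => b i j)
  have hf : ∀ i j, inner ℂ (f i) (f j) = if i = j then (d i : ℂ) * d i else 0 := fun i j => by
    have := congrFun (congrFun hbb i) j
    rw [diagonal_apply] at this
    rw [← this, mul_apply]
    simp [f, PiLp.inner_apply, star_apply, mul_comm]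
  have hnorm : ∀ i, ‖f i‖ = d i := fun i => by
    have := hf i i
    rw [if_pos rfl, inner_self_eq_norm_sq_to_K] at this
    have h2 : ‖f i‖ ^ 2 = d i ^ 2 := by
      rw [pow_two (d i)]; exact Complex.ofReal_injective (by simpa using this)
    exact (pow_left_inj₀ (norm_nonneg _) (hd0 i) two_ne_zero).1 h2
  -- On orthogonal vectors Gram–Schmidt only normalizes; the basis also supplies unit vectors where
  -- the column is zero.
  let q := InnerProductSpace.gramSchmidtOrthonormalBasis (𝕜 := ℂ) (E := EuclideanSpace ℂ (Fin n)) (by simp) f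
  have hq : ∀ i, f i = (d i : ℂ) • q i := fun i => by
    by_cases hi : f i = 0
    · have : d i = 0 := by rw [← hnorm, hi, norm_zero]
      rw [this, hi]; simp
    · rw [InnerProductSpace.gramSchmidtOrthonormalBasis_apply_of_orthogonal _ _ hi, smul_smul, hnorm]
      · have : (d i : ℂ) ≠ 0 := by
          rw [← hnorm]; exact_mod_cast norm_ne_zero_iff.2 hi
        simp [mul_inv_cancel₀ this]
      · intro i j hij
        simp [hf, hij]
  let u : Matrix (Fin n) (Fin n) ℂ := of fun i j => q j i
  refine ⟨u, ?_, v, hv, d, hd0, hd, ?_⟩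
  · rw [mem_unitaryGroup_iff']
    ext i j
    have := orthonormal_iff_ite.1 q.orthonormal i j
    rw [one_apply, ← this, mul_apply]
    simp [u, PiLp.inner_apply, star_apply, mul_comm]
  · have hbu : b = u * diagonal (fun i => (d i : ℂ)) := by
      ext i j
      have := congrArg (fun x : EuclideanSpace ℂ (Fin n) => x i) (hq j)
      simpa [f, u, mul_comm] using this
    rw [← hbu, hb, mul_assoc, hv'', mul_one]

/-! ### The von Neumann type trace inequality -/

/-- By Birkhoff's theorem `S` is a convex combination of permutation matrices, and for each of these
the bound is the rearrangement inequality. -/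
theorem sum_mul_doublyStochastic_mul_le {n : ℕ} {S : Matrix (Fin n) (Fin n) ℝ}
    (hS : S ∈ doublyStochastic ℝ (Fin n)) {c d : Fin n → ℝ} (hc : Antitone c) (hd : Antitone d) :
    ∑ i, ∑ j, c i * S i j * d j ≤ ∑ i, c i * d i := by
  obtain ⟨w, hw0, hw1, rfl⟩ := exists_eq_sum_perm_of_mem_doublyStochastic hS
  have h1 : ∑ i, ∑ j, c i * (∑ σ : Equiv.Perm (Fin n), w σ • σ.permMatrix ℝ) i j * d j =
      ∑ σ : Equiv.Perm (Fin n), w σ * ∑ i, c i * d (σ i) := by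
    simp_rw [Matrix.sum_apply, Finset.mul_sum, Finset.sum_mul]
    rw [Finset.sum_congr rfl fun i _ => Finset.sum_comm, Finset.sum_comm]
    refine Finset.sum_congr rfl fun σ _ => Finset.sum_congr rfl fun i _ => ?_
    simp [PEquiv.toMatrix_apply, Equiv.toPEquiv_apply]
    ring
  have hcd : Monovary c d := fun i j hij => hc (le_of_not_ge fun h => hij.not_ge (hd h))
  rw [h1]
  calc _ ≤ ∑ σ : Equiv.Perm (Fin n), w σ * ∑ i, c i * d i :=
        Finset.sum_le_sum fun σ _ => mul_le_mul_of_nonneg_left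
          (hcd.sum_mul_comp_perm_le_sum_mul) (hw0 σ)
    _ = _ := by rw [← Finset.sum_mul, hw1, one_mul]

theorem normSq_mem_doublyStochastic {n : ℕ} {u : Matrix (Fin n) (Fin n) ℂ}
    (hu : u ∈ unitaryGroup (Fin n) ℂ) :
    of (fun i j => ‖u i j‖ ^ 2) ∈ doublyStochastic ℝ (Fin n) := by
  rw [mem_doublyStochastic_iff_sum]
  refine ⟨fun i j => sq_nonneg _, fun i => ?_, fun j => ?_⟩
  · have := congrFun (congrFun (mem_unitaryGroup_iff.1 hu) i) i
    rw [mul_apply, one_apply_eq] at this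
    apply Complex.ofReal_injective
    simpa [star_apply, Complex.mul_conj'] using this
  · have := congrFun (congrFun (mem_unitaryGroup_iff'.1 hu) j) j
    rw [mul_apply, one_apply_eq] at this
    apply Complex.ofReal_injective
    simpa [star_apply, Complex.conj_mul'] using this

theorem re_sum_mul_unitary_mul_diagonal_mul_le {n : ℕ} {u v : Matrix (Fin n) (Fin n) ℂ}
    (hu : u ∈ unitaryGroup (Fin n) ℂ) (hv : v ∈ unitaryGroup (Fin n) ℂ) {c d : Fin n → ℝ}
    (hc0 : 0 ≤ c) (hd0 : 0 ≤ d) (hc : Antitone c) (hd : Antitone d) :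
    (∑ i, (c i : ℂ) * (u * diagonal (fun i => (d i : ℂ)) * v) i i).re ≤ ∑ i, c i * d i := by
  have h1 := sum_mul_doublyStochastic_mul_le (normSq_mem_doublyStochastic hu) hc hd
  have h2 := sum_mul_doublyStochastic_mul_le
    (transpose_mem_doublyStochastic_iff.2 (normSq_mem_doublyStochastic hv)) hc hd
  have h3 : (∑ i, (c i : ℂ) * (u * diagonal (fun i => (d i : ℂ)) * v) i i).re ≤
      ∑ i, ∑ j, (c i * ‖u i j‖ ^ 2 * d j + c i * ‖v j i‖ ^ 2 * d j) / 2 := by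
    rw [Complex.re_sum]
    refine Finset.sum_le_sum fun i _ => ?_
    rw [Complex.re_ofReal_mul, mul_apply, Complex.re_sum, Finset.mul_sum]
    refine Finset.sum_le_sum fun j _ => ?_
    rw [mul_diagonal]
    have h4 : (u i j * d j * v j i).re ≤ ‖u i j‖ * d j * ‖v j i‖ := by
      refine (Complex.re_le_norm _).trans_eq ?_
      rw [norm_mul, norm_mul, Complex.norm_real, Real.norm_of_nonneg (hd0 j)]
    have h5 := mul_le_mul_of_nonneg_left h4 (hc0 i)
    -- AM-GM replaces `‖u i j‖ * ‖v j i‖` by the mean of the squares, which form two doubly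
    -- stochastic matrices.
    have h6 := mul_nonneg (mul_nonneg (hc0 i) (hd0 j)) (sq_nonneg (‖u i j‖ - ‖v j i‖))
    linarith
  simp only [← Finset.sum_div, Finset.sum_add_distrib] at h3
  simp only [of_apply, transpose_apply] at h1 h2
  linarith

/-- The variational bound for the norm `|||·|||_α` of a concave function `α`. -/
theorem re_sum_increments_mul_le_choquetNorm {α : ℕ → ℝ} (h0 : α 0 = 0) {n : ℕ}
    (hc0 : 0 ≤ increments α n) (hc : Antitone (increments α n)) {u v : Matrix (Fin n) (Fin n) ℂ}
    (hu : u ∈ unitaryGroup (Fin n) ℂ) (hv : v ∈ unitaryGroup (Fin n) ℂ)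
    (a : Matrix (Fin n) (Fin n) ℂ) :
    (∑ i, (increments α n i : ℂ) * (u * a * v) i i).re ≤ choquetNorm α a := by
  obtain ⟨p, hp, q, hq, d, hd0, hd, rfl⟩ := exists_singular_value_decomposition a
  rw [choquetNorm_unitary_mul_diagonal_mul α h0 hp hq hd0 hd]
  have := re_sum_mul_unitary_mul_diagonal_mul_le (mul_mem hu hp) (mul_mem hq hv) hc0 hd0 hc hd
  simpa only [mul_assoc] using this

/-! ### Norm properties -/

theorem choquetNorm_unitary_mul_mul {α : ℕ → ℝ} (h0 : α 0 = 0) {n : ℕ}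
    {u v : Matrix (Fin n) (Fin n) ℂ} (hu : u ∈ unitaryGroup (Fin n) ℂ)
    (hv : v ∈ unitaryGroup (Fin n) ℂ) (a : Matrix (Fin n) (Fin n) ℂ) :
    choquetNorm α (u * a * v) = choquetNorm α a := by
  obtain ⟨p, hp, q, hq, d, hd0, hd, rfl⟩ := exists_singular_value_decomposition a
  rw [choquetNorm_unitary_mul_diagonal_mul α h0 hp hq hd0 hd,
    ← choquetNorm_unitary_mul_diagonal_mul α h0 (mul_mem hu hp) (mul_mem hq hv) hd0 hd]
  simp only [mul_assoc]

theorem choquetNorm_conjTranspose {α : ℕ → ℝ} (h0 : α 0 = 0) {n : ℕ}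
    (a : Matrix (Fin n) (Fin n) ℂ) : choquetNorm α aᴴ = choquetNorm α a := by
  obtain ⟨p, hp, q, hq, d, hd0, hd, rfl⟩ := exists_singular_value_decomposition a
  rw [choquetNorm_unitary_mul_diagonal_mul α h0 hp hq hd0 hd,
    ← choquetNorm_unitary_mul_diagonal_mul α h0 (Unitary.star_mem hq) (Unitary.star_mem hp) hd0 hd]
  congr 1
  simp [conjTranspose_mul, diagonal_conjTranspose, mul_assoc, star_eq_conjTranspose,
    Pi.star_def]

theorem choquetNorm_nonneg {α : ℕ → ℝ} (h0 : α 0 = 0) {n : ℕ} (hc0 : 0 ≤ increments α n)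
    (a : Matrix (Fin n) (Fin n) ℂ) : 0 ≤ choquetNorm α a := by
  obtain ⟨p, hp, q, hq, d, hd0, hd, rfl⟩ := exists_singular_value_decomposition a
  rw [choquetNorm_unitary_mul_diagonal_mul α h0 hp hq hd0 hd]
  exact Finset.sum_nonneg fun i _ => mul_nonneg (hc0 i) (hd0 i)

/-- Since `c_1 = α 1 > 0`, a vanishing norm kills the largest singular value, hence all of them. -/
theorem choquetNorm_eq_zero_iff {α : ℕ → ℝ} (h0 : α 0 = 0) (h1 : 0 < α 1) {n : ℕ}
    (hc0 : 0 ≤ increments α n) (a : Matrix (Fin n) (Fin n) ℂ) :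
    choquetNorm α a = 0 ↔ a = 0 := by
  obtain ⟨p, hp, q, hq, d, hd0, hd, rfl⟩ := exists_singular_value_decomposition a
  rw [choquetNorm_unitary_mul_diagonal_mul α h0 hp hq hd0 hd]
  constructor
  · intro h
    have h2 := (Finset.sum_eq_zero_iff_of_nonneg fun i _ => mul_nonneg (hc0 i) (hd0 i)).1 h
    have hd' : d = 0 := by
      funext i
      have hn : 0 < n := i.pos
      have h3 := h2 ⟨0, hn⟩ (Finset.mem_univ _)
      have h4 : d ⟨0, hn⟩ = 0 := by
        refine (mul_eq_zero.1 h3).resolve_left (ne_of_gt ?_)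
        simpa [increments, h0] using h1
      exact le_antisymm ((hd (Fin.mk_le_of_le_val (Nat.zero_le i))).trans_eq h4) (hd0 i)
    simp [hd']
  · intro h
    have h2 : diagonal (fun i => (d i : ℂ)) = 0 := by
      have := congrArg (fun x => star p * x * star q) h
      simp only [mul_assoc, mem_unitaryGroup_iff.1 hq, mul_one, mul_zero, zero_mul] at this
      rwa [← mul_assoc, mem_unitaryGroup_iff'.1 hp, one_mul] at this
    refine Finset.sum_eq_zero fun i _ => ?_
    have := congrFun (congrFun h2 i) i
    rw [diagonal_apply_eq, Matrix.zero_apply] at this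
    rw [Complex.ofReal_eq_zero.1 this, mul_zero]

theorem choquetNorm_smul {α : ℕ → ℝ} (h0 : α 0 = 0) {n : ℕ} (z : ℂ)
    (a : Matrix (Fin n) (Fin n) ℂ) : choquetNorm α (z • a) = ‖z‖ * choquetNorm α a := by
  obtain ⟨p, hp, q, hq, d, hd0, hd, rfl⟩ := exists_singular_value_decomposition a
  obtain ⟨w, hw, hz⟩ : ∃ w : ℂ, star w * w = 1 ∧ z = ‖z‖ * w := by
    refine ⟨Complex.exp (z.arg * Complex.I), ?_, (Complex.norm_mul_exp_arg_mul_I z).symm⟩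
    rw [Complex.star_def, Complex.conj_mul', Complex.norm_exp_ofReal_mul_I]
    simp
  have hwp : w • p ∈ unitaryGroup (Fin n) ℂ := by
    rw [mem_unitaryGroup_iff', star_smul, smul_mul_smul_comm, mem_unitaryGroup_iff'.1 hp, hw,
      one_smul]
  have key : z • (p * diagonal (fun i => (d i : ℂ)) * q) =
      (w • p) * diagonal (fun i => ((‖z‖ * d i : ℝ) : ℂ)) * q := by
    have : diagonal (fun i => ((‖z‖ * d i : ℝ) : ℂ)) = (‖z‖ : ℂ) • diagonal (fun i => (d i : ℂ)) := by
      rw [← diagonal_smul]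
      congr 1
      funext i
      simp
    rw [this, Matrix.mul_smul, Matrix.smul_mul, Matrix.smul_mul, Matrix.smul_mul, smul_smul, ← hz]
  rw [key, choquetNorm_unitary_mul_diagonal_mul α h0 hp hq hd0 hd,
    choquetNorm_unitary_mul_diagonal_mul α h0 hwp hq
      (fun i => mul_nonneg (norm_nonneg z) (hd0 i))
      (fun i j hij => mul_le_mul_of_nonneg_left (hd hij) (norm_nonneg z)), Finset.mul_sum]
  exact Finset.sum_congr rfl fun i _ => by ring

theorem choquetNorm_add_le {α : ℕ → ℝ} (h0 : α 0 = 0) {n : ℕ}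
    (hc0 : 0 ≤ increments α n) (hc : Antitone (increments α n)) (a b : Matrix (Fin n) (Fin n) ℂ) :
    choquetNorm α (a + b) ≤ choquetNorm α a + choquetNorm α b := by
  -- The unitaries that diagonalize `a + b` attain its norm, while for `a` and `b` separately they
  -- give only lower bounds.
  obtain ⟨p, hp, q, hq, d, hd0, hd, h⟩ := exists_singular_value_decomposition (a + b)
  have ha := re_sum_increments_mul_le_choquetNorm h0 hc0 hc (Unitary.star_mem hp)
    (Unitary.star_mem hq) a
  have hb := re_sum_increments_mul_le_choquetNorm h0 hc0 hc (Unitary.star_mem hp)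
    (Unitary.star_mem hq) b
  refine le_trans (le_of_eq ?_) (add_le_add ha hb)
  rw [← Complex.add_re, ← Finset.sum_add_distrib]
  simp_rw [← mul_add, ← Matrix.add_apply, ← add_mul, ← mul_add]
  have h2 : star p * (a + b) * star q = diagonal (fun i => (d i : ℂ)) := by
    rw [h]
    simp only [mul_assoc, mem_unitaryGroup_iff.1 hq, mul_one]
    rw [← mul_assoc, mem_unitaryGroup_iff'.1 hp, one_mul]
  rw [h2, h, choquetNorm_unitary_mul_diagonal_mul α h0 hp hq hd0 hd, Complex.re_sum]
  simp

theorem isUnitarilyInvariantNorm_choquetNorm {α : ℕ → ℝ} (h0 : α 0 = 0) (h1 : 0 < α 1) {n : ℕ}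
    (hc0 : 0 ≤ increments α n) (hc : Antitone (increments α n)) :
    IsUnitarilyInvariantNorm (fun a : Matrix (Fin n) (Fin n) ℂ => choquetNorm α a) where
  nonneg := choquetNorm_nonneg h0 hc0
  eq_zero_iff := choquetNorm_eq_zero_iff h0 h1 hc0
  smul := choquetNorm_smul h0
  add_le := choquetNorm_add_le h0 hc0 hc
  unitary_mul_mul _ hu _ hv := choquetNorm_unitary_mul_mul h0 hu hv

/-! ### 2-positivity for decreasing increments -/

/-- The order on `ℂ` also requires equal imaginary parts; positivity of `a` makes the diagonal real.
-/
theorem sum_increments_mul_le_choquetNorm {α : ℕ → ℝ} (h0 : α 0 = 0) {n : ℕ}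
    (hc0 : 0 ≤ increments α n) (hc : Antitone (increments α n)) {u : Matrix (Fin n) (Fin n) ℂ}
    (hu : u ∈ unitaryGroup (Fin n) ℂ) {a : Matrix (Fin n) (Fin n) ℂ} (ha : a.PosSemidef) :
    ∑ i, (increments α n i : ℂ) * (uᴴ * a * u) i i ≤ choquetNorm α a := by
  rw [Complex.le_def]
  refine ⟨re_sum_increments_mul_le_choquetNorm h0 hc0 hc (Unitary.star_mem hu) hu a, ?_⟩
  rw [Complex.im_sum, Complex.ofReal_im]
  refine Finset.sum_eq_zero fun i _ => ?_
  have := (Complex.nonneg_iff.1 ((ha.conjTranspose_mul_mul_same u).diag_nonneg (i := i))).2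
  rw [Complex.im_ofReal_mul, ← this, mul_zero]

theorem isTwoPositive_choquetNorm {α : ℕ → ℝ} (h0 : α 0 = 0) {n : ℕ}
    (hc0 : 0 ≤ increments α n) (hc : Antitone (increments α n)) :
    IsTwoPositive (fun a : Matrix (Fin n) (Fin n) ℂ => (choquetNorm α a : ℂ)) := by
  intro a b c h
  have ha : a.PosSemidef := h.submatrix Sum.inl
  have hb : b.PosSemidef := h.submatrix Sum.inr
  simp only [choquetNorm_conjTranspose h0]
  obtain ⟨p, hp, q, hq, d, hd0, hd, hcd⟩ := exists_singular_value_decomposition c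
  have hq' : qᴴ ∈ unitaryGroup (Fin n) ℂ := Unitary.star_mem hq
  -- This conjugation turns the corner `c` into `diagonal d`; the `2 × 2` compressions at index `i`,
  -- weighted by the increments, are then summed.
  have hT := h.conjTranspose_mul_mul_same (fromBlocks p 0 0 qᴴ)
  have h2 : pᴴ * c * qᴴ = diagonal (fun i => (d i : ℂ)) := by
    rw [hcd]
    simp only [mul_assoc, ← star_eq_conjTranspose, mem_unitaryGroup_iff.1 hq, mul_one]
    rw [← mul_assoc, mem_unitaryGroup_iff'.1 hp, one_mul]
  have h3 : q * cᴴ * p = diagonal (fun i => (d i : ℂ)) := by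
    have := congrArg conjTranspose h2
    simpa [conjTranspose_mul, mul_assoc, diagonal_conjTranspose, Pi.star_def] using this
  simp only [fromBlocks_conjTranspose, fromBlocks_multiply, conjTranspose_zero, zero_mul, mul_zero,
    add_zero, zero_add, conjTranspose_conjTranspose, h2, h3] at hT
  have hi : ∀ i, (increments α n i • !![(pᴴ * a * p) i i, (d i : ℂ); (d i : ℂ),
      (qᴴᴴ * b * qᴴ) i i]).PosSemidef := fun i => by
    refine PosSemidef.smul ?_ (hc0 i)
    convert hT.submatrix ![Sum.inl i, Sum.inr i] using 1
    ext k l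
    fin_cases k <;> fin_cases l <;> simp
  have hs := posSemidef_sum Finset.univ fun i _ => hi i
  have hda := sub_nonneg.2 (sum_increments_mul_le_choquetNorm h0 hc0 hc hp ha)
  have hdb := sub_nonneg.2 (sum_increments_mul_le_choquetNorm h0 hc0 hc hq' hb)
  -- The sum already has off-diagonal entries `|||c|||_α`; adding the nonnegative slack raises the
  -- diagonal to `|||a|||_α`, `|||b|||_α`.
  have hdiag : (diagonal ![_, _]).PosSemidef :=
    PosSemidef.diagonal (Fin.forall_fin_two.2 ⟨hda, hdb⟩)
  convert hs.add hdiag using 1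
  have hcn : choquetNorm α c = ∑ i, increments α n i * d i := by
    rw [hcd, choquetNorm_unitary_mul_diagonal_mul α h0 hp hq hd0 hd]
  ext k l
  fin_cases k <;> fin_cases l <;> simp [Matrix.sum_apply, hcn]

/-! ### Test matrices and necessity of concavity -/

/-- The sequence `p, …, p, q, r, 0, …` with `q` in position `m`. -/
def stepSeq (m : ℕ) (p q r : ℝ) (i : ℕ) : ℝ :=
  if i < m then p else if i = m then q else if i = m + 1 then r else 0

theorem sum_increments_mul_stepSeq {α : ℕ → ℝ} (h0 : α 0 = 0) {n m : ℕ} (hm : m + 1 < n)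
    (p q r : ℝ) :
    ∑ i : Fin n, increments α n i * stepSeq m p q r i =
      p * α m + q * (α (m + 1) - α m) + r * (α (m + 2) - α (m + 1)) := by
  have h1 : ∑ i : Fin n, increments α n i * stepSeq m p q r i =
      ∑ i ∈ Finset.range n, (α (i + 1) - α i) * stepSeq m p q r i :=
    (Finset.sum_range fun i => (α (i + 1) - α i) * stepSeq m p q r i).symm
  rw [h1, ← Finset.sum_subset (Finset.range_mono (show m + 2 ≤ n from hm)), Finset.sum_range_succ,
    Finset.sum_range_succ]
  · have h2 : ∑ i ∈ Finset.range m, (α (i + 1) - α i) * stepSeq m p q r i = p * α m := by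
      have h3 := Finset.sum_range_sub α m
      rw [h0, sub_zero] at h3
      rw [← h3, Finset.mul_sum]
      refine Finset.sum_congr rfl fun i hi => ?_
      rw [stepSeq, if_pos (Finset.mem_range.1 hi), mul_comm]
    rw [h2]
    simp [stepSeq]
    ring
  · intro i _ hi
    rw [Finset.mem_range] at hi
    rw [stepSeq, if_neg (by omega), if_neg (by omega), if_neg (by omega), mul_zero]

theorem stepSeq_nonneg (m : ℕ) {p q r : ℝ} (hp : 0 ≤ p) (hq : 0 ≤ q) (hr : 0 ≤ r) (i : ℕ) :
    0 ≤ stepSeq m p q r i := by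
  unfold stepSeq
  split_ifs <;> simp [*]

theorem stepSeq_antitone (m : ℕ) {p q r : ℝ} (hqp : q ≤ p) (hrq : r ≤ q) (hr : 0 ≤ r) :
    Antitone (stepSeq m p q r) := by
  intro i j hij
  unfold stepSeq
  split_ifs <;> first | omega | linarith

/-- The diagonal matrix with entries `stepSeq m p q r`. -/
noncomputable def stepMatrix (n m : ℕ) (p q r : ℝ) : Matrix (Fin n) (Fin n) ℂ :=
  diagonal fun i => (stepSeq m p q r i : ℂ)

theorem stepMatrix_add (n m : ℕ) (p q r p' q' r' : ℝ) :
    stepMatrix n m p q r + stepMatrix n m p' q' r' = stepMatrix n m (p + p') (q + q') (r + r') := by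
  rw [stepMatrix, stepMatrix, stepMatrix, diagonal_add]
  congr 1
  funext i
  unfold stepSeq
  split_ifs <;> simp

theorem stepMatrix_mul (n m : ℕ) (p q r p' q' r' : ℝ) :
    stepMatrix n m p q r * stepMatrix n m p' q' r' = stepMatrix n m (p * p') (q * q') (r * r') := by
  rw [stepMatrix, stepMatrix, stepMatrix, diagonal_mul_diagonal]
  congr 1
  funext i
  unfold stepSeq
  split_ifs <;> simp

theorem conjTranspose_stepMatrix (n m : ℕ) (p q r : ℝ) :
    (stepMatrix n m p q r)ᴴ = stepMatrix n m p q r := by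
  rw [stepMatrix, diagonal_conjTranspose]
  congr 1
  funext i
  simp

theorem choquetNorm_stepMatrix {α : ℕ → ℝ} (h0 : α 0 = 0) {n m : ℕ} (hm : m + 1 < n)
    {p q r : ℝ} (hqp : q ≤ p) (hrq : r ≤ q) (hr : 0 ≤ r) :
    choquetNorm α (stepMatrix n m p q r) =
      p * α m + q * (α (m + 1) - α m) + r * (α (m + 2) - α (m + 1)) := by
  have := choquetNorm_unitary_mul_diagonal_mul α h0 (one_mem (unitaryGroup (Fin n) ℂ)) (one_mem _)
    (d := fun i : Fin n => stepSeq m p q r i)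
    (fun i => stepSeq_nonneg m (by linarith) (by linarith) hr i)
    (fun i j hij => stepSeq_antitone m hqp hrq hr hij)
  rw [one_mul, mul_one, sum_increments_mul_stepSeq h0 hm] at this
  exact this

theorem choquetNorm_diagonal_comp_perm {α : ℕ → ℝ} (h0 : α 0 = 0) {n : ℕ}
    (σ : Equiv.Perm (Fin n)) (d : Fin n → ℂ) :
    choquetNorm α (diagonal (d ∘ σ)) = choquetNorm α (diagonal d) := by
  have h1 : star ((1 : Matrix (Fin n) (Fin n) ℂ).submatrix id σ) =
      (1 : Matrix (Fin n) (Fin n) ℂ).submatrix σ id := by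
    rw [star_eq_conjTranspose, conjTranspose_submatrix, conjTranspose_one]
  have hu : (1 : Matrix (Fin n) (Fin n) ℂ).submatrix σ id ∈ unitaryGroup (Fin n) ℂ := by
    rw [mem_unitaryGroup_iff, ← h1, star_star, h1, ← submatrix_mul _ _ _ _ _ Function.bijective_id,
      one_mul, submatrix_one_equiv]
  rw [← choquetNorm_unitary_mul_mul h0 hu (Unitary.star_mem hu) (diagonal d), ← h1, star_star, h1]
  congr 1
  ext i j
  by_cases hij : i = j <;> simp [mul_apply, one_apply, diagonal_apply, hij]

theorem choquetNorm_stepMatrix_swap {α : ℕ → ℝ} (h0 : α 0 = 0) {n m : ℕ} (hm : m + 1 < n)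
    (p q r : ℝ) :
    choquetNorm α (stepMatrix n m p r q) = choquetNorm α (stepMatrix n m p q r) := by
  rw [stepMatrix, stepMatrix, ← choquetNorm_diagonal_comp_perm h0
    (Equiv.swap ⟨m, by omega⟩ ⟨m + 1, hm⟩) fun i => (stepSeq m p q r i : ℂ)]
  congr 2
  funext i
  rw [Function.comp_apply, Equiv.swap_apply_def]
  unfold stepSeq
  split_ifs <;> simp_all [Fin.ext_iff]

theorem concave_of_choquetNorm_add_le {α : ℕ → ℝ} (h0 : α 0 = 0) {n : ℕ}
    (h : ∀ a b : Matrix (Fin n) (Fin n) ℂ,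
      choquetNorm α (a + b) ≤ choquetNorm α a + choquetNorm α b) {m : ℕ} (hm : m + 1 < n) :
    (α (m + 2) + α m) / 2 ≤ α (m + 1) := by
  -- Both summands have norm `α (m + 1)`; the sum has step values `2, 1, 1` and norm `α m + α (m +
  -- 2)`.
  have := h (stepMatrix n m 1 1 0) (stepMatrix n m 1 0 1)
  rw [choquetNorm_stepMatrix_swap h0 hm 1 1 0, stepMatrix_add,
    choquetNorm_stepMatrix h0 hm (by norm_num) (by norm_num) (by norm_num),
    choquetNorm_stepMatrix h0 hm (by norm_num) (by norm_num) (by norm_num)] at this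
  linarith

theorem posSemidef_fromBlocks_mul {n : ℕ} (x y : Matrix (Fin n) (Fin n) ℂ) :
    (fromBlocks (xᴴ * x) (xᴴ * y) (xᴴ * y)ᴴ (yᴴ * y)).PosSemidef := by
  simpa [fromBlocks_conjTranspose, fromBlocks_multiply] using
    posSemidef_conjTranspose_mul_self
      (fromBlocks x y 0 0 : Matrix (Fin n ⊕ Fin n) (Fin n ⊕ Fin n) ℂ)

theorem concave_of_isTwoPositive {α : ℕ → ℝ} (h0 : α 0 = 0) {n : ℕ} (hc0 : 0 ≤ increments α n)
    (h : IsTwoPositive (fun a : Matrix (Fin n) (Fin n) ℂ => (choquetNorm α a : ℂ))) {m : ℕ}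
    (hm : m + 1 < n) : (α (m + 2) + α m) / 2 ≤ α (m + 1) := by
  have key : ∀ s : ℝ, 0 ≤ s → s < 1 → α m + s * α (m + 2) ≤ (1 + s) * α (m + 1) := by
    intro s hs0 hs1
    -- The diagonal blocks have step values `1, s², 1` and `1, 1, s²`, hence equal norms, and the
    -- corner has `1, s, s`. The determinant then bounds the corner's norm by theirs, and the
    -- difference carries a factor `1 - s`.
    have hP := h _ _ _ (posSemidef_fromBlocks_mul (stepMatrix n m 1 s 1) (stepMatrix n m 1 1 s))
    have hdet := hP.det_nonneg
    simp only [conjTranspose_stepMatrix, stepMatrix_mul,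
      det_fin_two_of, mul_one, one_mul] at hdet
    rw [choquetNorm_stepMatrix_swap h0 hm 1 1 (s * s)] at hdet
    norm_cast at hdet
    have hle : choquetNorm α (stepMatrix n m 1 s s) ≤ choquetNorm α (stepMatrix n m 1 1 (s * s)) :=
      abs_le_of_sq_le_sq' (by linarith) (choquetNorm_nonneg h0 hc0 _) |>.2
    rw [choquetNorm_stepMatrix h0 hm hs1.le le_rfl hs0,
      choquetNorm_stepMatrix h0 hm le_rfl (by nlinarith) (by positivity)] at hle
    have : (1 - s) * (α m + s * α (m + 2)) ≤ (1 - s) * ((1 + s) * α (m + 1)) := by linarith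
    exact le_of_mul_le_mul_left this (by linarith)
  -- At `s = 1` that factor vanishes, so the inequality there is obtained by closedness.
  have hlim : α m + 1 * α (m + 2) ≤ (1 + 1) * α (m + 1) := by
    have hcl : IsClosed {s : ℝ | α m + s * α (m + 2) ≤ (1 + s) * α (m + 1)} :=
      isClosed_le (by fun_prop) (by fun_prop)
    have hsub : Set.Ico (0 : ℝ) 1 ⊆ {s : ℝ | α m + s * α (m + 2) ≤ (1 + s) * α (m + 1)} :=
      fun s hs => key s hs.1 hs.2
    exact closure_minimal hsub hcl (by rw [closure_Ico zero_ne_one]; simp)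
  linarith

/-! ### Passing between `α` and its increments; the equivalence -/

theorem increments_nonneg {α : ℕ → ℝ} {n : ℕ} (hα : MonotoneOn α (Set.Iic n)) :
    0 ≤ increments α n := fun i =>
  sub_nonneg.2 (hα (Set.mem_Iic.2 i.2.le) (Set.mem_Iic.2 i.2) (Nat.le_succ _))

theorem antitoneOn_sub_of_concave {α : ℕ → ℝ} {n : ℕ}
    (h : ∀ i : ℕ, 1 ≤ i → i < n → (α (i + 1) + α (i - 1)) / 2 ≤ α i) :
    AntitoneOn (fun i : ℕ => α i - α (i - 1)) (Set.Icc 1 n) := by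
  intro i hi j hj hij
  induction j, hij using Nat.le_induction with
  | base => exact le_rfl
  | succ k hk ih =>
    refine le_trans ?_ (ih ⟨hi.1.trans hk, by have := hj.2; omega⟩)
    have := h k (hi.1.trans hk) hj.2
    simp only [Nat.add_sub_cancel]
    linarith

theorem increments_antitone {α : ℕ → ℝ} {n : ℕ}
    (h : AntitoneOn (fun i : ℕ => α i - α (i - 1)) (Set.Icc 1 n)) : Antitone (increments α n) :=
  fun i j hij => h ⟨Nat.le_add_left 1 i, i.2⟩ ⟨Nat.le_add_left 1 j, j.2⟩
    (Nat.succ_le_succ hij)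

theorem mainTheorem3 (n : ℕ) (hn : 1 ≤ n) (α : ℕ → ℝ) (hα : MonotoneOn α (Set.Iic n))
    (hα0 : α 0 = 0) (hα1 : 0 < α 1) :
    List.TFAE
      [∀ i : ℕ, 1 ≤ i → i < n → (α (i + 1) + α (i - 1)) / 2 ≤ α i,
        AntitoneOn (fun i : ℕ => α i - α (i - 1)) (Set.Icc 1 n),
        IsUnitarilyInvariantNorm
          (fun a : Matrix (Fin n) (Fin n) ℂ => choquetNorm α a),
        IsTwoPositive
          (fun a : Matrix (Fin n) (Fin n) ℂ => (choquetNorm α a : ℂ))] := by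
  have hc0 := increments_nonneg hα
  tfae_have 1 → 2 := antitoneOn_sub_of_concave
  tfae_have 2 → 3 := fun h =>
    isUnitarilyInvariantNorm_choquetNorm hα0 hα1 hc0 (increments_antitone h)
  tfae_have 2 → 4 := fun h => isTwoPositive_choquetNorm hα0 hc0 (increments_antitone h)
  tfae_have 3 → 1 := by
    intro h i hi hin
    obtain ⟨m, rfl⟩ := Nat.exists_eq_add_of_le' hi
    exact concave_of_choquetNorm_add_le hα0 h.add_le hin
  tfae_have 4 → 1 := by
    intro h i hi hin
    obtain ⟨m, rfl⟩ := Nat.exists_eq_add_of_le' hi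
    exact concave_of_isTwoPositive hα0 hc0 h hin
  tfae_finish
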